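/- Let $(W(t))_{t\ge 0}$ and $(\widetilde W(t))_{t\ge 0}$ be two independent standard real Brownian motions (with almost surely continuous paths) on a probability space $(\Omega,\mathcal F,\mathbb P)$, and extend $W$ to $\mathbb R$ by $W(t)=\widetilde W(-t)$ for $t<0$. Let $\rho\colon\mathbb R\to[0,\infty)$ be smooth and symmetric with $\rho=0$ outside $[-1,1]$ and $\int\rho(x)\,dx=1$. Let $\gamma>0$ and, for $\varepsilon>0$, set $\rho^\varepsilon(x)=\varepsilon^{-\gamma}\rho(x/\varepsilon^{\gamma})$ and $$W^\varepsilon(t)=\int_{-\infty}^{\infty}\rho^\varepsilon(t-s)\,W(s)\,ds,\qquad \xi^\varepsilon(t)=\dot W^\varepsilon(t),\qquad t\in\mathbb R.$$ Then almost surely, for all $\varepsilon>0$, the integral converges absolutely for every $t\in\mathbb R$ and $W^\varepsilon$ is differentiable on $\mathbb R$, and the following hold. (i) For every $\varepsilon>0$, $(\xi^\varepsilon(t))_{t\in\mathbb R}$ is a stationary centered Gaussian process, and $\mathbb E[\xi^\varepsilon(t)^2]=\varepsilon^{-\gamma}\|\rho\|_{L^2(\mathbb R)}^2$ for all $t$.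 (ii) The correlation length of $\xi^\varepsilon$ is $2\varepsilon^{\gamma}$ in the following sense: for every $\varepsilon>0$, if $|s-t|\ge 2\varepsilon^\gamma$, then $\xi^\varepsilon(s)$ and $\xi^\varepsilon(t)$ are independent. (iii) For every $\tilde\gamma>\gamma$ and every $T>0$ there is a non-random constant $C$ such that $$\mathbb P\Bigl[\exists\,\varepsilon_0>0\ \ \forall\,0<\varepsilon\le\varepsilon_0:\ \sup_{0\le t\le T}|\xi^\varepsilon(t)|\le C\,\varepsilon^{-\tilde\gamma/2}\Bigr]=1 .$$ In particular, if $\gamma<2/3$, then for every $T>0$ there is a non-random constant $C$ such that almost surely there is $\varepsilon_0>0$ with $\sup_{0\le t\le T}|\xi^\varepsilon(t)|\le C\,\varepsilon^{-1/3}$ for all $0<\varepsilon\le\varepsilon_0$. -/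

import Mathlib

open MeasureTheory ProbabilityTheory Set
open scoped NNReal

noncomputable section

namespace MollifiedNoise

/-- A mollifying kernel on the line: smooth, nonnegative, symmetric, vanishing outside `[-1, 1]`
and of total mass one. -/
structure IsMollifyingKernel (ρ : ℝ → ℝ) : Prop where
  smooth : ContDiff ℝ (⊤ : ℕ∞) ρ
  nonneg : ∀ x, 0 ≤ ρ x
  symm : ∀ x, ρ (-x) = ρ x
  eq_zero : ∀ x, x ∉ Icc (-1 : ℝ) 1 → ρ x = 0
  integral_eq_one : ∫ x, ρ x = 1

/-- The rescaled kernel `x ↦ ε ^ (-γ) * ρ (x / ε ^ γ)`. -/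
def scaledKernel (ρ : ℝ → ℝ) (γ ε : ℝ) (x : ℝ) : ℝ :=
  ε ^ (-γ) * ρ (x / ε ^ γ)

variable {Ω : Type*}

/-- The two-sided process obtained from two processes `B` and `B'` on the half-line:
`W t = B t` for `0 ≤ t` and `W t = B' (-t)` for `t < 0`. -/
def twoSided (B B' : ℝ≥0 → Ω → ℝ) (t : ℝ) (ω : Ω) : ℝ :=
  if 0 ≤ t then B t.toNNReal ω else B' (-t).toNNReal ω

/-- The mollified process `t ↦ ∫ s, ρ^ε (t - s) * W s`, computed path by path. -/
def mollified (ρ : ℝ → ℝ) (γ ε : ℝ) (W : ℝ → Ω → ℝ) (t : ℝ) (ω : Ω) : ℝ :=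
  ∫ s, scaledKernel ρ γ ε (t - s) * W s ω

/-- The noise: the pathwise time derivative of the mollified process. -/
def noise (ρ : ℝ → ℝ) (γ ε : ℝ) (W : ℝ → Ω → ℝ) (t : ℝ) (ω : Ω) : ℝ :=
  deriv (fun r => mollified ρ γ ε W r ω) t

/-- A real-valued process on the line is (strictly) stationary if its finite-dimensional
distributions are invariant under time shifts. -/
def IsStationary [MeasurableSpace Ω] (X : ℝ → Ω → ℝ) (P : Measure Ω) : Prop :=
  ∀ (h : ℝ) (I : Finset ℝ),
    IdentDistrib (fun ω => I.restrict (fun t => X (t + h) ω))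
      (fun ω => I.restrict (fun t => X t ω)) P P

end MollifiedNoise

end

/-! The noise is a Wiener integral, ξ(t) = ∫ ρ^ε(t - r) dW(r). Moving the time derivative onto the
kernel gives the pathwise formula `noise_eq`, which is this integral after integration by parts. For
C¹ integrands g of compact support, -∫ g' W is the almost sure limit of Riemann sums against
independent increments, hence centered Gaussian with variance ∫ g²
(`hasLaw_neg_integral_deriv_mul`).

Every linear combination of noise values is such an integral (`hasLaw_sum_noise`), so
finite-dimensional laws are determined by L² norms of combinations of translated kernels.
Translation invariance gives stationarity, scaling gives the variance, and almost disjoint supports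
give zero covariance, hence independence by joint Gaussianity.

The growth bound is pathwise, so it holds for all small ε at once. The derivative of the kernel has
mean zero, whence |ξ(t)| ≤ ε^(-γ) ‖ρ'‖₁ times the oscillation of W at scale ε^γ (`abs_noise_le`).
Hölder continuity of exponent α < 1/2 (`ae_holder`, by dyadic chaining) gives order ε^(-γ(1-α)), and
γ(1-α) < γ'/2 for α close to 1/2. -/

noncomputable section

namespace MollifiedNoise

open Filter Topology
open scoped ENNReal

/-! ### Limits of Gaussian variables, and Riemann sums on a regular grid -/

section

variable {Ω : Type*} [MeasurableSpace Ω] {P : Measure Ω}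

/-- An almost sure limit of centered Gaussian variables whose variances converge is Gaussian, with
the limiting variance. -/
theorem hasLaw_gaussianReal_of_tendsto_ae [IsProbabilityMeasure P] {X : ℕ → Ω → ℝ} {Y : Ω → ℝ}
    {v : ℕ → ℝ≥0} {u : ℝ≥0} (hX : ∀ n, HasLaw (X n) (gaussianReal 0 (v n)) P)
    (hv : Tendsto v atTop (𝓝 u)) (hY : ∀ᵐ ω ∂P, Tendsto (fun n => X n ω) atTop (𝓝 (Y ω))) :
    HasLaw Y (gaussianReal 0 u) P := by
  have hYm : AEMeasurable Y P :=
    aemeasurable_of_tendsto_metrizable_ae atTop (fun n => (hX n).aemeasurable) hY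
  have := Measure.isProbabilityMeasure_map hYm (μ := P)
  refine ⟨hYm, Measure.ext_of_charFun ?_⟩
  ext t
  -- The same characteristic functions converge in two ways: by dominated convergence along the
  -- paths, and through the explicit Gaussian formula.
  have h1 : Tendsto (fun n => charFun (P.map (X n)) t) atTop (𝓝 (charFun (P.map Y) t)) := by
    simp_rw [charFun_apply_real]
    rw [integral_map hYm (by fun_prop)]
    simp_rw [fun n => integral_map (hX n).aemeasurable
      (f := fun x : ℝ => Complex.exp (t * x * Complex.I)) (by fun_prop)]
    refine tendsto_integral_of_dominated_convergence (fun _ => 1) (fun n => ?_)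
      (integrable_const _) (fun n => ?_) ?_
    · have := (hX n).aemeasurable
      exact AEMeasurable.aestronglyMeasurable (by fun_prop)
    · refine ae_of_all _ fun ω => ?_
      rw [← Complex.ofReal_mul, Complex.norm_exp_ofReal_mul_I]
    · filter_upwards [hY] with ω hω
      have hc : Continuous fun x : ℝ => Complex.exp (t * x * Complex.I) := by fun_prop
      exact (hc.tendsto _).comp hω
  have h2 : Tendsto (fun n => charFun (P.map (X n)) t) atTop (𝓝 (charFun (gaussianReal 0 u) t)) := by
    simp_rw [fun n => (hX n).map_eq, charFun_gaussianReal]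
    have hc : Continuous fun x : ℝ≥0 =>
        Complex.exp (t * (0 : ℝ) * Complex.I - ((x : ℝ) : ℂ) * t ^ 2 / 2) := by fun_prop
    exact (hc.tendsto _).comp hv
  exact tendsto_nhds_unique h1 h2

/-- The smallest multiple of `1 / (n + 1)` that is at least `r`. -/
def gridCeil (n : ℕ) (r : ℝ) : ℝ := ⌈((n : ℝ) + 1) * r⌉ / ((n : ℝ) + 1)

lemma measurable_gridCeil (n : ℕ) : Measurable (gridCeil n) := by
  unfold gridCeil
  have : Measurable fun r : ℝ => ⌈((n : ℝ) + 1) * r⌉ :=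
    Int.measurable_ceil.comp (by fun_prop)
  have h2 : Measurable fun r : ℝ => ((⌈((n : ℝ) + 1) * r⌉ : ℤ) : ℝ) :=
    measurable_from_top.comp this
  fun_prop

lemma le_gridCeil (n : ℕ) (r : ℝ) : r ≤ gridCeil n r := by
  rw [gridCeil, le_div_iff₀ (by positivity), mul_comm]
  exact Int.le_ceil _

lemma gridCeil_le (n : ℕ) (r : ℝ) : gridCeil n r ≤ r + 1 / ((n : ℝ) + 1) := by
  have h : (0 : ℝ) < (n : ℝ) + 1 := by positivity
  rw [gridCeil, div_le_iff₀ h, add_mul r, div_mul_cancel₀ _ h.ne']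
  have := Int.ceil_lt_add_one (((n : ℝ) + 1) * r)
  linarith

/-- Meant for step functions φ that round to a grid: `F ∘ φ` need not be continuous, but it is
bounded because φ keeps a bounded interval within a compact one. -/
lemma intervalIntegrable_mul_comp {h F φ : ℝ → ℝ} (hh : Continuous h) (hF : Continuous F)
    (hφ : Measurable φ) (hφ1 : ∀ r, |φ r - r| ≤ 1) (a b : ℝ) :
    IntervalIntegrable (fun r => h r * F (φ r)) volume a b := by
  obtain ⟨C, hC⟩ := (isCompact_Icc (a := min a b - 1) (b := max a b + 1)).exists_bound_of_continuousOn
    hF.continuousOn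
  refine IntervalIntegrable.continuousOn_mul ?_ hh.continuousOn
  rw [intervalIntegrable_iff]
  refine Measure.integrableOn_of_bounded (M := C) ?_ ?_ ?_
  · simp
  · exact (hF.measurable.comp hφ).aestronglyMeasurable
  · refine (ae_restrict_iff' measurableSet_uIoc).2 (ae_of_all _ fun r hr => hC _ ?_)
    have h1 := abs_le.1 (hφ1 r)
    rw [uIoc, mem_Ioc] at hr
    constructor <;> linarith [hr.1, hr.2]

lemma tendsto_intervalIntegral_mul_comp {h F : ℝ → ℝ} {φ : ℕ → ℝ → ℝ} (hh : Continuous h)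
    (hF : Continuous F) (hφ : ∀ n, Measurable (φ n))
    (hφ1 : ∀ n r, |φ n r - r| ≤ 1 / ((n : ℝ) + 1)) (a b : ℝ) :
    Tendsto (fun n => ∫ r in a..b, h r * F (φ n r)) atTop (𝓝 (∫ r in a..b, h r * F r)) := by
  have hle : ∀ n r, |φ n r - r| ≤ 1 := fun n r => (hφ1 n r).trans <| by
    rw [div_le_one (by positivity)]; simp
  obtain ⟨C, hC⟩ := (isCompact_Icc (a := min a b - 1) (b := max a b + 1)).exists_bound_of_continuousOn
    hF.continuousOn
  refine intervalIntegral.tendsto_integral_filter_of_dominated_convergence (fun r => |h r| * C)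
    ?_ ?_ ?_ ?_
  · exact Eventually.of_forall fun n =>
      (intervalIntegrable_mul_comp hh hF (hφ n) (hle n) a b).def'.aestronglyMeasurable
  · refine Eventually.of_forall fun n => ae_of_all _ fun r hr => ?_
    rw [norm_mul, Real.norm_eq_abs]
    refine mul_le_mul_of_nonneg_left (hC _ ?_) (abs_nonneg _)
    have h1 := abs_le.1 (hle n r)
    rw [uIoc, mem_Ioc] at hr
    constructor <;> linarith [hr.1, hr.2]
  · exact (Continuous.intervalIntegrable (by fun_prop) _ _)
  · refine ae_of_all _ fun r _ => ?_
    have hlim : Tendsto (fun n => φ n r) atTop (𝓝 r) := by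
      rw [tendsto_iff_dist_tendsto_zero]
      exact squeeze_zero (fun _ => dist_nonneg) (fun n => hφ1 n r)
        tendsto_one_div_add_atTop_nhds_zero_nat
    exact ((hF.tendsto r).comp hlim).const_mul _

/-- The point `-N + i / (n + 1)` of the regular grid. -/
def gridPoint (N n i : ℕ) : ℝ := -N + i / ((n : ℝ) + 1)

lemma gridPoint_zero (N n : ℕ) : gridPoint N n 0 = -N := by simp [gridPoint]

lemma gridPoint_last (N n : ℕ) : gridPoint N n (2 * N * (n + 1)) = N := by
  have h : (n : ℝ) + 1 ≠ 0 := by positivity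
  simp [gridPoint]; field_simp; ring

lemma gridPoint_succ (N n i : ℕ) :
    gridPoint N n (i + 1) = gridPoint N n i + 1 / ((n : ℝ) + 1) := by
  simp [gridPoint]; ring

lemma gridCeil_eq {N n i : ℕ} {r : ℝ} (hr : r ∈ Ioc (gridPoint N n i) (gridPoint N n (i + 1))) :
    gridCeil n r = gridPoint N n (i + 1) := by
  have h : (0 : ℝ) < (n : ℝ) + 1 := by positivity
  have key : ⌈((n : ℝ) + 1) * r⌉ = -(N : ℤ) * (n + 1) + (i + 1) := by
    rw [Int.ceil_eq_iff]
    obtain ⟨h1, h2⟩ := hr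
    rw [gridPoint_succ] at h2
    rw [gridPoint] at h1 h2
    have e1 := mul_lt_mul_of_pos_left h1 h
    have e2 := mul_le_mul_of_nonneg_left h2 h.le
    have e3 : ((n : ℝ) + 1) * (-N + i / ((n : ℝ) + 1)) = -N * (n + 1) + i := by field_simp
    rw [mul_add _ _ (1 / _), e3, mul_one_div_cancel h.ne'] at e2
    rw [e3] at e1
    push_cast
    constructor <;> linarith
  rw [gridCeil, key, gridPoint]
  push_cast
  field_simp

/-- Serves both sampling rules: right endpoints with weight g' for the path, left endpoints with
weight 1 for the variance. -/
lemma sum_integral_gridPoint {h F : ℝ → ℝ} {φ : ℝ → ℝ} (hh : Continuous h) (hF : Continuous F)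
    (hφ : Measurable φ) (hφ1 : ∀ r, |φ r - r| ≤ 1) (N n : ℕ) (y : ℕ → ℝ)
    (hy : ∀ i, ∀ r ∈ Ioc (gridPoint N n i) (gridPoint N n (i + 1)), φ r = y i) :
    ∑ i ∈ Finset.range (2 * N * (n + 1)),
      (∫ r in gridPoint N n i..gridPoint N n (i + 1), h r) * F (y i) =
      ∫ r in (-N : ℝ)..N, h r * F (φ r) := by
  rw [← gridPoint_zero N n, ← gridPoint_last N n,
    ← intervalIntegral.sum_integral_adjacent_intervals
      (fun k _ => intervalIntegrable_mul_comp hh hF hφ hφ1 _ _)]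
  refine Finset.sum_congr rfl fun i _ => ?_
  rw [← intervalIntegral.integral_mul_const]
  refine intervalIntegral.integral_congr_uIoo fun r hr => ?_
  have hle : gridPoint N n i ≤ gridPoint N n (i + 1) := by
    rw [gridPoint_succ]; have : 0 ≤ 1 / ((n : ℝ) + 1) := by positivity
    linarith
  rw [uIoo_of_le hle] at hr
  rw [hy i r (Ioo_subset_Ioc_self hr)]

/-- The stochastic Riemann sum of `g` against the increments of `w` along the regular grid. -/
def riemannSum (g w : ℝ → ℝ) (N n : ℕ) : ℝ :=
  ∑ i ∈ Finset.range (2 * N * (n + 1)),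
    g (gridPoint N n i) * (w (gridPoint N n (i + 1)) - w (gridPoint N n i))

lemma abs_gridCeil_sub_le (n : ℕ) (r : ℝ) : |gridCeil n r - r| ≤ 1 / ((n : ℝ) + 1) :=
  abs_le.2 ⟨by have := le_gridCeil n r; have : 0 ≤ 1 / ((n : ℝ) + 1) := by positivity
               linarith, by linarith [gridCeil_le n r]⟩

lemma one_div_natCast_add_one_le_one (n : ℕ) : 1 / ((n : ℝ) + 1) ≤ 1 := by
  rw [div_le_one (by positivity)]; simp

/-- Summation by parts: the products g·w telescope to zero, and the differences of g become
integrals of g'. The path is then sampled at right endpoints, and its continuity alone suffices for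
the limit. -/
lemma riemannSum_eq {g w : ℝ → ℝ} (hg : ContDiff ℝ 1 g) (hw : Continuous w) (N n : ℕ)
    (h0 : g (-N) = 0) (h1 : g N = 0) :
    riemannSum g w N n = -∫ r in (-N : ℝ)..N, deriv g r * w (gridCeil n r) := by
  have hd : Continuous (deriv g) := hg.continuous_deriv le_rfl
  rw [← sum_integral_gridPoint hd hw (measurable_gridCeil n)
    (fun r => (abs_gridCeil_sub_le n r).trans (one_div_natCast_add_one_le_one n)) N n
    (fun i => gridPoint N n (i + 1)) (fun i r hr => gridCeil_eq hr)]
  have ht := Finset.sum_range_sub (fun i => g (gridPoint N n i) * w (gridPoint N n i))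
    (2 * N * (n + 1))
  rw [gridPoint_zero, gridPoint_last, h0, h1, zero_mul, zero_mul, sub_zero] at ht
  rw [eq_neg_iff_add_eq_zero, riemannSum, ← Finset.sum_add_distrib, ← ht]
  refine Finset.sum_congr rfl fun i _ => ?_
  rw [intervalIntegral.integral_deriv_eq_sub (fun x _ => hg.differentiable one_ne_zero x)
    (hd.intervalIntegrable _ _)]
  ring

lemma tendsto_riemannSum {g w : ℝ → ℝ} (hg : ContDiff ℝ 1 g) (hw : Continuous w) (N : ℕ)
    (h0 : g (-N) = 0) (h1 : g N = 0) :
    Tendsto (riemannSum g w N) atTop (𝓝 (-∫ r in (-N : ℝ)..N, deriv g r * w r)) := by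
  simp_rw [funext fun n => riemannSum_eq hg hw N n h0 h1]
  exact (tendsto_intervalIntegral_mul_comp (hg.continuous_deriv le_rfl) hw measurable_gridCeil
    abs_gridCeil_sub_le _ _).neg

lemma tendsto_sum_sq {g : ℝ → ℝ} (hg : Continuous g) (N : ℕ) :
    Tendsto (fun n : ℕ => ∑ i ∈ Finset.range (2 * N * (n + 1)),
      1 / ((n : ℝ) + 1) * g (gridPoint N n i) ^ 2) atTop
      (𝓝 (∫ r in (-N : ℝ)..N, g r ^ 2)) := by
  have hm : ∀ n : ℕ, Measurable fun r => gridCeil n r - 1 / ((n : ℝ) + 1) := fun n =>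
    (measurable_gridCeil n).sub_const _
  have hb : ∀ (n : ℕ) r, |gridCeil n r - 1 / ((n : ℝ) + 1) - r| ≤ 1 / ((n : ℝ) + 1) := fun n r =>
    abs_le.2 ⟨by linarith [le_gridCeil n r], by
      have := gridCeil_le n r; have : 0 ≤ 1 / ((n : ℝ) + 1) := by positivity
      linarith⟩
  have h := tendsto_intervalIntegral_mul_comp (h := fun _ => 1) continuous_const (hg.pow 2) hm hb
    (-N) N
  simp only [one_mul] at h
  refine h.congr fun n => ?_
  have := sum_integral_gridPoint (h := fun _ => 1) continuous_const (hg.pow 2) (hm n)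
    (fun r => (hb n r).trans (one_div_natCast_add_one_le_one n)) N n (gridPoint N n)
    (fun i r hr => by rw [gridCeil_eq hr, gridPoint_succ]; ring)
  simp only [one_mul] at this
  rw [← this]
  refine Finset.sum_congr rfl fun i _ => ?_
  rw [gridPoint_succ]
  simp

end

/-! ### Two-sided Brownian motion and its Wiener integral -/

section

variable {Ω : Type*} [MeasurableSpace Ω] {P : Measure Ω}

/-- Two independent Gaussian processes are jointly Gaussian. -/
theorem isGaussianProcess_sumElim {S T : Type*} {X : S → Ω → ℝ} {Y : T → Ω → ℝ}
    (hX : IsGaussianProcess X P) (hY : IsGaussianProcess Y P)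
    (hXY : IndepFun (fun ω s => X s ω) (fun ω t => Y t ω) P) :
    IsGaussianProcess (Sum.elim X Y) P where
  hasGaussianLaw I := by
    have hind : IndepFun (fun ω => I.toLeft.restrict (X · ω)) (fun ω => I.toRight.restrict (Y · ω))
        P := hXY.comp (Finset.measurable_restrict I.toLeft) (Finset.measurable_restrict I.toRight)
    have h := hind.hasGaussianLaw (hX.hasGaussianLaw I.toLeft) (hY.hasGaussianLaw I.toRight)
    let L : (I.toLeft → ℝ) × (I.toRight → ℝ) →L[ℝ] I → ℝ := ContinuousLinearMap.pi fun i =>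
      match i with
      | ⟨.inl s, hs⟩ => (ContinuousLinearMap.proj (R := ℝ) (φ := fun _ : I.toLeft => ℝ)
          ⟨s, Finset.mem_toLeft.2 hs⟩).comp (ContinuousLinearMap.fst ℝ _ _)
      | ⟨.inr t, ht⟩ => (ContinuousLinearMap.proj (R := ℝ) (φ := fun _ : I.toRight => ℝ)
          ⟨t, Finset.mem_toRight.2 ht⟩).comp (ContinuousLinearMap.snd ℝ _ _)
    have he : (fun ω => I.restrict (Sum.elim X Y · ω)) =
        L ∘ fun ω => (I.toLeft.restrict (X · ω), I.toRight.restrict (Y · ω)) := by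
      funext ω i
      obtain ⟨i | i, hi⟩ := i <;> simp [L, Finset.restrict_def]
    rw [he]
    exact h.map L

/-- A two-sided Brownian motion: a centered Gaussian process on the line with covariance
`(|s| + |t| - |s - t|) / 2` and almost surely continuous paths. -/
structure IsTwoSidedBrownian (W : ℝ → Ω → ℝ) (P : Measure Ω) : Prop where
  isGaussianProcess : IsGaussianProcess W P
  integral_eval : ∀ t, ∫ ω, W t ω ∂P = 0
  covariance_eval : ∀ s t, cov[W s, W t; P] = (|s| + |t| - |s - t|) / 2
  cont : ∀ᵐ ω ∂P, Continuous (W · ω)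

theorem isTwoSidedBrownian_twoSided {B B' : ℝ≥0 → Ω → ℝ} (hB : IsBrownianReal B P)
    (hB' : IsBrownianReal B' P) (hindep : IndepFun (fun ω t => B t ω) (fun ω t => B' t ω) P) :
    IsTwoSidedBrownian (twoSided B B') P where
  isGaussianProcess := by
    have h := isGaussianProcess_sumElim hB.isGaussianProcess hB'.isGaussianProcess hindep
    have he : twoSided B B' = Sum.elim B B' ∘
        fun t : ℝ => if 0 ≤ t then Sum.inl t.toNNReal else Sum.inr (-t).toNNReal := by
      funext t ω
      by_cases ht : 0 ≤ t <;> simp [twoSided, ht]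
    rw [he]
    exact h.comp_right _
  integral_eval t := by
    by_cases ht : 0 ≤ t
    · simpa [twoSided, ht] using hB.integral_eval t.toNNReal
    · simpa [twoSided, ht] using hB'.integral_eval (-t).toNNReal
  covariance_eval s t := by
    have hi : ∀ a b, cov[B a, B' b; P] = 0 := fun a b =>
      (hindep.comp (measurable_pi_apply a) (measurable_pi_apply b)).covariance_eq_zero
        (hB.isGaussianProcess.hasGaussianLaw_eval a).memLp_two
        (hB'.isGaussianProcess.hasGaussianLaw_eval b).memLp_two
    have e1 : ∀ t, 0 ≤ t → twoSided B B' t = B t.toNNReal := fun t ht => by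
      ext ω; simp [twoSided, ht]
    have e2 : ∀ t, ¬ 0 ≤ t → twoSided B B' t = B' (-t).toNNReal := fun t ht => by
      ext ω; simp [twoSided, ht]
    -- For times on opposite sides of 0, |s - t| = |s| + |t|, so the formula vanishes, as
    -- independence requires.
    by_cases hs : 0 ≤ s <;> by_cases ht : 0 ≤ t
    · rw [e1 s hs, e1 t ht, hB.covariance_eval, NNReal.coe_min, Real.coe_toNNReal _ hs,
        Real.coe_toNNReal _ ht, abs_of_nonneg hs, abs_of_nonneg ht]
      rcases le_total s t with h | h
      · rw [min_eq_left h, abs_of_nonpos (by linarith)]; ring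
      · rw [min_eq_right h, abs_of_nonneg (by linarith)]; ring
    · rw [e1 s hs, e2 t ht, hi]
      push Not at ht
      rw [abs_of_nonneg hs, abs_of_neg ht, abs_of_nonneg (by linarith)]; ring
    · rw [e2 s hs, e1 t ht, covariance_comm, hi]
      push Not at hs
      rw [abs_of_nonneg ht, abs_of_neg hs, abs_of_neg (by linarith)]; ring
    · rw [e2 s hs, e2 t ht, hB'.covariance_eval, NNReal.coe_min]
      push Not at hs ht
      rw [Real.coe_toNNReal _ (by linarith), Real.coe_toNNReal _ (by linarith), abs_of_neg hs,
        abs_of_neg ht]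
      rcases le_total s t with h | h
      · rw [min_eq_right (by linarith), abs_of_nonpos (by linarith)]; ring
      · rw [min_eq_left (by linarith), abs_of_nonneg (by linarith)]; ring
  cont := by
    filter_upwards [hB.cont, hB'.cont, hB.eval_zero_ae_eq_zero, hB'.eval_zero_ae_eq_zero]
      with ω h h' h0 h0'
    unfold twoSided
    refine Continuous.if_le (h.comp continuous_real_toNNReal)
      (h'.comp (continuous_real_toNNReal.comp continuous_neg)) continuous_const continuous_id ?_
    rintro x rfl
    simp [h0, h0']

namespace IsTwoSidedBrownian

variable {W : ℝ → Ω → ℝ}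

lemma isProbabilityMeasure (hW : IsTwoSidedBrownian W P) : IsProbabilityMeasure P :=
  hW.isGaussianProcess.isProbabilityMeasure

lemma memLp_two (hW : IsTwoSidedBrownian W P) (t : ℝ) : MemLp (W t) 2 P :=
  (hW.isGaussianProcess.hasGaussianLaw_eval t).memLp_two

lemma covariance_sub_sub (hW : IsTwoSidedBrownian W P) (a b c d : ℝ) :
    cov[fun ω => W b ω - W a ω, fun ω => W d ω - W c ω; P] =
      (|a - d| + |b - c| - |a - c| - |b - d|) / 2 := by
  have := hW.isProbabilityMeasure
  rw [covariance_fun_sub_fun_sub (hW.memLp_two _) (hW.memLp_two _) (hW.memLp_two _)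
    (hW.memLp_two _)]
  have h := hW.covariance_eval
  simp only [h]
  ring

/-- Increments are centered Gaussian, with variance the length of the time interval. -/
lemma hasLaw_sub (hW : IsTwoSidedBrownian W P) (s t : ℝ) :
    HasLaw (fun ω => W t ω - W s ω) (gaussianReal 0 (|t - s|).toNNReal) P := by
  have := hW.isProbabilityMeasure
  have hg : HasGaussianLaw (fun ω => W t ω - W s ω) P :=
    hW.isGaussianProcess.hasGaussianLaw_fun_sub
  refine ⟨hg.aemeasurable, ?_⟩
  rw [hg.map_eq_gaussianReal, ← covariance_self hg.aemeasurable, hW.covariance_sub_sub,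
    integral_sub ((hW.memLp_two _).integrable (by norm_num))
      ((hW.memLp_two _).integrable (by norm_num)), hW.integral_eval, hW.integral_eval]
  congr 2
  · simp
  · rw [abs_sub_comm s t]; simp

lemma hasLaw_riemannSum (hW : IsTwoSidedBrownian W P) (g : ℝ → ℝ) (N n : ℕ) :
    HasLaw (fun ω => riemannSum g (W · ω) N n) (gaussianReal 0
      (∑ i ∈ Finset.range (2 * N * (n + 1)),
        1 / ((n : ℝ) + 1) * g (gridPoint N n i) ^ 2).toNNReal) P := by
  have := hW.isProbabilityMeasure
  let D : ℕ → Ω → ℝ := fun i ω =>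
    g (gridPoint N n i) * (W (gridPoint N n (i + 1)) ω - W (gridPoint N n i) ω)
  have hD : IsGaussianProcess D P := by
    classical
    refine hW.isGaussianProcess.of_isGaussianProcess fun i =>
      ⟨{gridPoint N n i, gridPoint N n (i + 1)},
        g (gridPoint N n i) • (.proj ⟨gridPoint N n (i + 1), by simp⟩ -
          .proj ⟨gridPoint N n i, by simp⟩), fun ω => by simp [D]⟩
  have hg : HasGaussianLaw (fun ω => riemannSum g (W · ω) N n) P := hD.hasGaussianLaw_fun_sum
  refine ⟨hg.aemeasurable, ?_⟩
  rw [hg.map_eq_gaussianReal]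
  congr 2
  · simp only [riemannSum]
    rw [integral_finsetSum _ fun i _ => (hD.hasGaussianLaw_eval i).integrable]
    refine Finset.sum_eq_zero fun i _ => ?_
    rw [integral_const_mul, (hW.hasLaw_sub _ _).integral_eq, integral_id_gaussianReal, mul_zero]
  · simp only [riemannSum]
    rw [variance_fun_sum' fun i _ => (hD.hasGaussianLaw_eval i).memLp_two]
    refine Finset.sum_congr rfl fun i hi => ?_
    have hh : (0 : ℝ) < 1 / ((n : ℝ) + 1) := by positivity
    set h : ℝ := 1 / ((n : ℝ) + 1)
    have hp : ∀ i j : ℕ, gridPoint N n i - gridPoint N n j = h * ((i : ℝ) - j) := fun i j => by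
      simp only [gridPoint, h]; ring
    -- The variance is a double sum of covariances; increments over distinct grid cells are
    -- uncorrelated, so only the diagonal remains.
    rw [Finset.sum_eq_single_of_mem i hi]
    · simp only [D]
      rw [covariance_const_mul_left, covariance_const_mul_right, hW.covariance_sub_sub]
      simp only [hp, abs_mul, abs_of_pos hh]
      push_cast
      simp
      ring
    · intro j _ hj
      simp only [D]
      rw [covariance_const_mul_left, covariance_const_mul_right, hW.covariance_sub_sub]
      simp only [hp, abs_mul, abs_of_pos hh]
      have : |(i : ℝ) - ((j + 1 : ℕ) : ℝ)| + |((i + 1 : ℕ) : ℝ) - j| - |(i : ℝ) - j| -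
          |((i + 1 : ℕ) : ℝ) - ((j + 1 : ℕ) : ℝ)| = 0 := by
        push_cast
        rcases lt_or_gt_of_ne hj with hj | hj
        · have : (j : ℝ) + 1 ≤ i := by exact_mod_cast hj
          rw [abs_of_nonneg (by linarith), abs_of_nonneg (by linarith), abs_of_nonneg (by linarith),
            abs_of_nonneg (by linarith)]; ring
        · have : (i : ℝ) + 1 ≤ j := by exact_mod_cast hj
          rw [abs_of_nonpos (by linarith), abs_of_nonpos (by linarith), abs_of_nonpos (by linarith),
            abs_of_nonpos (by linarith)]; ring
      linear_combination g (gridPoint N n i) * g (gridPoint N n j) * h / 2 * this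

/-- The Wiener integral of a compactly supported `C¹` function, computed path by path by
integration by parts, is a centered Gaussian variable whose variance is the squared `L²` norm. -/
theorem hasLaw_neg_integral_deriv_mul (hW : IsTwoSidedBrownian W P) {g : ℝ → ℝ}
    (hg : ContDiff ℝ 1 g) (hgs : HasCompactSupport g) :
    HasLaw (fun ω => -∫ r, deriv g r * W r ω) (gaussianReal 0 (∫ r, g r ^ 2).toNNReal) P := by
  have := hW.isProbabilityMeasure
  obtain ⟨R, hR⟩ := hgs.isCompact.isBounded.subset_closedBall 0
  obtain ⟨N, hN⟩ := exists_nat_gt R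
  have hzero : ∀ r, r ∉ Ioc (-N : ℝ) N → r ∉ tsupport g := fun r hr hr' => by
    have := hR hr'
    rw [mem_closedBall_zero_iff, Real.norm_eq_abs, abs_le] at this
    exact hr ⟨by linarith, by linarith⟩
  have hs : ∀ r, r ∉ tsupport g → g r = 0 := fun r hr => image_eq_zero_of_notMem_tsupport hr
  have hs' : ∀ r, r ∉ tsupport g → deriv g r = 0 := fun r hr =>
    image_eq_zero_of_notMem_tsupport fun h => hr (tsupport_deriv_subset h)
  have h1 : ∀ {f : ℝ → ℝ}, (∀ r, r ∉ tsupport g → f r = 0) →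
      ∫ r, f r = ∫ r in (-N : ℝ)..N, f r := fun {f} hf => by
    rw [intervalIntegral.integral_of_le (by linarith [N.cast_nonneg (α := ℝ)]),
      setIntegral_eq_integral_of_forall_compl_eq_zero fun r hr => hf r (hzero r hr)]
  refine hasLaw_gaussianReal_of_tendsto_ae (fun n => hW.hasLaw_riemannSum g N n) ?_ ?_
  · rw [h1 fun r hr => by rw [hs r hr]; simp]
    exact tendsto_real_toNNReal (tendsto_sum_sq hg.continuous N)
  · filter_upwards [hW.cont] with ω hω
    rw [h1 fun r hr => by rw [hs' r hr]; simp]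
    -- The right endpoint lies in the half-open interval of `hzero`, so it needs the strict
    -- inequality R < N.
    have hgN : g N = 0 := by
      refine hs _ fun hr' => ?_
      have := hR hr'
      rw [mem_closedBall_zero_iff, Real.norm_eq_abs, abs_le] at this
      linarith
    exact tendsto_riemannSum hg hω N (hs _ (hzero _ (by simp))) hgN

end IsTwoSidedBrownian

end

/-! ### The mollified kernel and the Gaussian law of the noise -/

section

variable {Ω : Type*} {ρ : ℝ → ℝ} {γ ε : ℝ}

section Kernel

lemma IsMollifyingKernel.contDiff_scaledKernel (hρ : IsMollifyingKernel ρ) (γ ε : ℝ) :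
    ContDiff ℝ 1 (scaledKernel ρ γ ε) := by
  have h : ContDiff ℝ 1 ρ := hρ.smooth.of_le (by exact_mod_cast le_top)
  unfold scaledKernel
  fun_prop

lemma IsMollifyingKernel.scaledKernel_eq_zero (hρ : IsMollifyingKernel ρ) (hε : 0 < ε) {x : ℝ}
    (hx : ε ^ γ < |x|) : scaledKernel ρ γ ε x = 0 := by
  have hδ : 0 < ε ^ γ := Real.rpow_pos_of_pos hε γ
  rw [scaledKernel, hρ.eq_zero, mul_zero]
  rw [mem_Icc, ← abs_le, not_le, abs_div, abs_of_pos hδ, lt_div_iff₀ hδ, one_mul]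
  exact hx

lemma IsMollifyingKernel.hasCompactSupport_scaledKernel (hρ : IsMollifyingKernel ρ) (hε : 0 < ε) :
    HasCompactSupport (scaledKernel ρ γ ε) := by
  refine HasCompactSupport.intro (isCompact_Icc (a := -ε ^ γ) (b := ε ^ γ)) fun x hx => ?_
  rw [mem_Icc, ← abs_le, not_le] at hx
  exact hρ.scaledKernel_eq_zero hε hx

lemma IsMollifyingKernel.integrable_scaledKernel_mul (hρ : IsMollifyingKernel ρ) (hε : 0 < ε)
    {w : ℝ → ℝ} (hw : Continuous w) (t : ℝ) :
    Integrable fun s => scaledKernel ρ γ ε (t - s) * w s := by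
  have hc := (hρ.contDiff_scaledKernel γ ε).continuous
  exact Continuous.integrable_of_hasCompactSupport (by fun_prop)
    (((hρ.hasCompactSupport_scaledKernel hε).comp_homeomorph (Homeomorph.subLeft t)).mul_right)

lemma IsMollifyingKernel.integrable_deriv_scaledKernel_mul (hρ : IsMollifyingKernel ρ)
    (hε : 0 < ε) {w : ℝ → ℝ} (hw : Continuous w) (t : ℝ) :
    Integrable fun s => deriv (scaledKernel ρ γ ε) (t - s) * w s := by
  have hc := (hρ.contDiff_scaledKernel γ ε).continuous_deriv le_rfl
  exact Continuous.integrable_of_hasCompactSupport (by fun_prop)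
    (((hρ.hasCompactSupport_scaledKernel hε).deriv.comp_homeomorph (Homeomorph.subLeft t)).mul_right)

lemma IsMollifyingKernel.hasDerivAt_mollified (hρ : IsMollifyingKernel ρ) (hε : 0 < ε)
    {W : ℝ → Ω → ℝ} {ω : Ω} (hw : Continuous (W · ω)) (t : ℝ) :
    HasDerivAt (fun t => mollified ρ γ ε W t ω)
      (∫ s, deriv (scaledKernel ρ γ ε) (t - s) * W s ω) t := by
  have h := (hρ.hasCompactSupport_scaledKernel hε).hasDerivAt_convolution_left
    (ContinuousLinearMap.lsmul ℝ ℝ) (hρ.contDiff_scaledKernel γ ε)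
    (hw.locallyIntegrable (μ := volume)) t
  rw [convolution_eq_swap] at h
  have he : (fun t => mollified ρ γ ε W t ω) =
      convolution (scaledKernel ρ γ ε) (W · ω) (ContinuousLinearMap.lsmul ℝ ℝ) volume := by
    funext t
    rw [convolution_eq_swap]
    rfl
  rw [he]
  exact h

lemma IsMollifyingKernel.noise_eq (hρ : IsMollifyingKernel ρ) (hε : 0 < ε)
    {W : ℝ → Ω → ℝ} {ω : Ω} (hw : Continuous (W · ω)) (t : ℝ) :
    noise ρ γ ε W t ω = ∫ s, deriv (scaledKernel ρ γ ε) (t - s) * W s ω :=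
  (hρ.hasDerivAt_mollified hε hw t).deriv

lemma integral_scaledKernel_sq (ρ : ℝ → ℝ) (γ : ℝ) (hε : 0 < ε) (t : ℝ) :
    ∫ r, scaledKernel ρ γ ε (t - r) ^ 2 = ε ^ (-γ) * ∫ x, ρ x ^ 2 := by
  have hδ : 0 < ε ^ γ := Real.rpow_pos_of_pos hε γ
  rw [integral_sub_left_eq_self (fun r => scaledKernel ρ γ ε r ^ 2) volume t]
  simp only [scaledKernel, mul_pow]
  rw [integral_const_mul, Measure.integral_comp_div (fun x => ρ x ^ 2), abs_of_pos hδ,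
    Real.rpow_neg hε.le, smul_eq_mul]
  field_simp

end Kernel

section Law

variable [MeasurableSpace Ω] {P : Measure Ω} {W : ℝ → Ω → ℝ}

/-- A linear combination of values of the noise is centered Gaussian. -/
theorem IsTwoSidedBrownian.hasLaw_sum_noise (hW : IsTwoSidedBrownian W P)
    (hρ : IsMollifyingKernel ρ) (hε : 0 < ε) {ι : Type*} [Fintype ι] (c t : ι → ℝ) :
    HasLaw (fun ω => ∑ i, c i * noise ρ γ ε W (t i) ω)
      (gaussianReal 0 (∫ r, (∑ i, c i * scaledKernel ρ γ ε (t i - r)) ^ 2).toNNReal) P := by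
  have hk := hρ.contDiff_scaledKernel γ ε
  have hg : ContDiff ℝ 1 fun r => ∑ i, c i * scaledKernel ρ γ ε (t i - r) := by fun_prop
  have hs : HasCompactSupport fun r => ∑ i, c i * scaledKernel ρ γ ε (t i - r) := by
    have h : ∀ i, HasCompactSupport fun r => c i * scaledKernel ρ γ ε (t i - r) := fun i =>
      ((hρ.hasCompactSupport_scaledKernel hε).comp_homeomorph (Homeomorph.subLeft (t i))).mul_left
    classical
    induction (Finset.univ : Finset ι) using Finset.induction_on with
    | empty =>
      simp only [Finset.sum_empty]
      exact HasCompactSupport.zero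
    | insert i s hi ih =>
      simp only [Finset.sum_insert hi]
      exact (h i).add ih
  refine (hW.hasLaw_neg_integral_deriv_mul hg hs).congr ?_
  filter_upwards [hW.cont] with ω hω
  simp only [hρ.noise_eq hε hω]
  simp_rw [← integral_const_mul]
  rw [← integral_finsetSum _ fun i _ =>
    (hρ.integrable_deriv_scaledKernel_mul hε hω (t i)).const_mul _, ← integral_neg]
  refine integral_congr_ae (ae_of_all _ fun r => ?_)
  -- Differentiating in r instead of t flips the sign, which cancels the minus sign of the
  -- integration by parts.
  have hd : HasDerivAt (fun r => ∑ i, c i * scaledKernel ρ γ ε (t i - r))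
      (∑ i, c i * -deriv (scaledKernel ρ γ ε) (t i - r)) r := by
    refine HasDerivAt.fun_sum fun i _ => HasDerivAt.const_mul _ ?_
    have h1 : HasDerivAt (scaledKernel ρ γ ε) (deriv (scaledKernel ρ γ ε) (t i - r)) (t i - r) :=
      ((hk.differentiable one_ne_zero) _).hasDerivAt
    exact h1.comp_const_sub (t i) r
  simp only [hd.deriv, Finset.sum_mul, ← Finset.sum_neg_distrib]
  exact Finset.sum_congr rfl fun i _ => by ring

lemma IsTwoSidedBrownian.hasLaw_noise (hW : IsTwoSidedBrownian W P)
    (hρ : IsMollifyingKernel ρ) (hε : 0 < ε) (t : ℝ) :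
    HasLaw (noise ρ γ ε W t) (gaussianReal 0 (ε ^ (-γ) * ∫ x, ρ x ^ 2).toNNReal) P := by
  have h := hW.hasLaw_sum_noise (γ := γ) hρ hε (fun _ : Unit => 1) (fun _ => t)
  simpa [integral_scaledKernel_sq ρ γ hε t] using h

lemma IsTwoSidedBrownian.aemeasurable_restrict_noise (hW : IsTwoSidedBrownian W P)
    (hρ : IsMollifyingKernel ρ) (hε : 0 < ε) {ι : Type*} [Finite ι] (t : ι → ℝ) :
    AEMeasurable (fun ω i => noise ρ γ ε W (t i) ω) P :=
  aemeasurable_pi_lambda _ fun i => (hW.hasLaw_noise hρ hε (t i)).aemeasurable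

/-- The Cramér–Wold input: these one-dimensional laws determine the joint law, and they involve the
times only through the kernel. -/
lemma IsTwoSidedBrownian.map_dual_noise (hW : IsTwoSidedBrownian W P)
    (hρ : IsMollifyingKernel ρ) (hε : 0 < ε) {ι : Type*} [Fintype ι] [DecidableEq ι] (t : ι → ℝ)
    (L : (ι → ℝ) →L[ℝ] ℝ) :
    (P.map fun ω i => noise ρ γ ε W (t i) ω).map L = gaussianReal 0
      (∫ r, (∑ i, L (Pi.single i 1) * scaledKernel ρ γ ε (t i - r)) ^ 2).toNNReal := by
  rw [AEMeasurable.map_map_of_aemeasurable (by fun_prop)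
    (hW.aemeasurable_restrict_noise hρ hε t),
    ← (hW.hasLaw_sum_noise hρ hε (fun i => L (Pi.single i 1)) t).map_eq]
  congr 1
  funext ω
  simp only [Function.comp_apply]
  conv_lhs => rw [← LinearMap.sum_single_apply (fun _ : ι => ℝ) fun i => noise ρ γ ε W (t i) ω]
  rw [map_sum]
  refine Finset.sum_congr rfl fun i _ => ?_
  rw [mul_comm, ← smul_eq_mul, ← map_smul, ← Pi.single_smul, smul_eq_mul, mul_one]

theorem IsTwoSidedBrownian.isGaussianProcess_noise (hW : IsTwoSidedBrownian W P)
    (hρ : IsMollifyingKernel ρ) (hε : 0 < ε) : IsGaussianProcess (noise ρ γ ε W) P where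
  hasGaussianLaw I := by
    classical
    exact ⟨isGaussian_of_map_eq_gaussianReal fun L =>
      ⟨_, _, hW.map_dual_noise hρ hε (fun i : I => (i : ℝ)) L⟩⟩

theorem IsTwoSidedBrownian.isStationary_noise (hW : IsTwoSidedBrownian W P)
    (hρ : IsMollifyingKernel ρ) (hε : 0 < ε) : IsStationary (noise ρ γ ε W) P := by
  intro h I
  classical
  have := hW.isProbabilityMeasure
  have hm1 := hW.aemeasurable_restrict_noise (γ := γ) hρ hε (fun i : I => (i : ℝ) + h)
  have hm2 := hW.aemeasurable_restrict_noise (γ := γ) hρ hε (fun i : I => (i : ℝ))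
  have := Measure.isProbabilityMeasure_map hm1
  have := Measure.isProbabilityMeasure_map hm2
  refine ⟨hm1, hm2, ?_⟩
  change P.map (fun ω (i : I) => noise ρ γ ε W (i + h) ω) =
    P.map (fun ω (i : I) => noise ρ γ ε W i ω)
  refine Measure.ext_of_charFunDual ?_
  ext L
  -- Substituting r + h for r in the variance integral removes the time shift.
  rw [charFunDual_eq_charFun_map_one, charFunDual_eq_charFun_map_one,
    hW.map_dual_noise hρ hε (fun i : I => (i : ℝ) + h) L, hW.map_dual_noise hρ hε _ L,
    ← integral_add_right_eq_self (μ := volume) (fun r => (∑ i : I, L (Pi.single i 1) *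
      scaledKernel ρ γ ε ((i : ℝ) + h - r)) ^ 2) h]
  simp only [add_sub_add_right_eq_sub]

theorem IsTwoSidedBrownian.indepFun_noise (hW : IsTwoSidedBrownian W P)
    (hρ : IsMollifyingKernel ρ) (hε : 0 < ε) {s t : ℝ} (hst : 2 * ε ^ γ ≤ |s - t|) :
    IndepFun (noise ρ γ ε W s) (noise ρ γ ε W t) P := by
  have := hW.isProbabilityMeasure
  have hG := hW.isGaussianProcess_noise (γ := γ) hρ hε
  have hk := (hρ.contDiff_scaledKernel γ ε).continuous
  refine HasGaussianLaw.indepFun_of_covariance_eq_zero hG.hasGaussianLaw_prodMk ?_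
  have hs := (hW.hasLaw_noise (γ := γ) hρ hε s)
  have ht := (hW.hasLaw_noise (γ := γ) hρ hε t)
  have h2s : MemLp (noise ρ γ ε W s) 2 P := (hG.hasGaussianLaw_eval s).memLp_two
  have h2t : MemLp (noise ρ γ ε W t) 2 P := (hG.hasGaussianLaw_eval t).memLp_two
  have hsum := hW.hasLaw_sum_noise (γ := γ) hρ hε (fun _ : Fin 2 => 1) ![s, t]
  simp only [Fin.sum_univ_two, one_mul, Matrix.cons_val_zero, Matrix.cons_val_one] at hsum
  have hi : ∀ u, Integrable fun r => scaledKernel ρ γ ε (u - r) ^ 2 := fun u => by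
    have hc : HasCompactSupport fun r => scaledKernel ρ γ ε (u - r) * scaledKernel ρ γ ε (u - r) :=
      ((hρ.hasCompactSupport_scaledKernel hε).comp_homeomorph (Homeomorph.subLeft u)).mul_right
    refine Continuous.integrable_of_hasCompactSupport (by fun_prop) ?_
    simpa only [sq] using hc
  -- The two supports lie in closed intervals that can meet only at the midpoint, when |s - t| =
  -- 2ε^γ; hence equality almost everywhere.
  have hprod : (fun r => (scaledKernel ρ γ ε (s - r) + scaledKernel ρ γ ε (t - r)) ^ 2) =ᵐ[volume]
      fun r => scaledKernel ρ γ ε (s - r) ^ 2 + scaledKernel ρ γ ε (t - r) ^ 2 := by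
    have hne : ∀ᵐ r : ℝ, r ≠ (s + t) / 2 := by
      simp [ae_iff]
    filter_upwards [hne] with r hr
    have : scaledKernel ρ γ ε (s - r) * scaledKernel ρ γ ε (t - r) = 0 := by
      by_cases h1 : ε ^ γ < |s - r|
      · rw [hρ.scaledKernel_eq_zero hε h1, zero_mul]
      by_cases h2 : ε ^ γ < |t - r|
      · rw [hρ.scaledKernel_eq_zero hε h2, mul_zero]
      refine absurd ?_ hr
      push Not at h1 h2
      rw [abs_le] at h1 h2
      rcases le_abs'.1 hst with h | h <;> linarith [h1.1, h1.2, h2.1, h2.2]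
    linear_combination 2 * this
  -- Polarization: the variance of the sum equals the sum of the variances, so the covariance is
  -- zero.
  have hv := hsum.variance_eq
  rw [variance_id_gaussianReal, integral_congr_ae hprod, integral_add (hi s) (hi t),
    integral_scaledKernel_sq ρ γ hε, integral_scaledKernel_sq ρ γ hε,
    variance_fun_add h2s h2t, hs.variance_eq, ht.variance_eq, variance_id_gaussianReal] at hv
  have hpos : 0 ≤ ε ^ (-γ) * ∫ x, ρ x ^ 2 :=
    mul_nonneg (Real.rpow_nonneg hε.le _) (integral_nonneg fun _ => sq_nonneg _)
  rw [Real.coe_toNNReal _ hpos, Real.coe_toNNReal _ (by linarith)] at hv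
  linarith

lemma IsTwoSidedBrownian.integral_noise (hW : IsTwoSidedBrownian W P)
    (hρ : IsMollifyingKernel ρ) (hε : 0 < ε) (t : ℝ) : ∫ ω, noise ρ γ ε W t ω ∂P = 0 := by
  rw [(hW.hasLaw_noise hρ hε t).integral_eq, integral_id_gaussianReal]

lemma IsTwoSidedBrownian.integral_noise_sq (hW : IsTwoSidedBrownian W P)
    (hρ : IsMollifyingKernel ρ) (hε : 0 < ε) (t : ℝ) :
    ∫ ω, noise ρ γ ε W t ω ^ 2 ∂P = ε ^ (-γ) * ∫ x, ρ x ^ 2 := by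
  have h := hW.hasLaw_noise (γ := γ) hρ hε t
  rw [← variance_of_integral_eq_zero h.aemeasurable (hW.integral_noise hρ hε t), h.variance_eq,
    variance_id_gaussianReal, Real.coe_toNNReal]
  exact mul_nonneg (Real.rpow_nonneg hε.le _) (integral_nonneg fun _ => sq_nonneg _)

end Law

end

/-! ### Dyadic chaining and Hölder continuity of Brownian paths -/

section

section Chaining

/-- The largest multiple of `1 / 2 ^ n` that is at most `t`. -/
def dyadicFloor (n : ℕ) (t : ℝ) : ℝ := ⌊t * 2 ^ n⌋ / 2 ^ n

lemma abs_dyadicFloor_sub_le (n : ℕ) (t : ℝ) : |dyadicFloor n t - t| ≤ (1 / 2) ^ n := by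
  have h : (0 : ℝ) < 2 ^ n := by positivity
  have e : dyadicFloor n t - t = (⌊t * 2 ^ n⌋ - t * 2 ^ n) / 2 ^ n := by
    rw [dyadicFloor]; field_simp
  rw [e, abs_div, abs_of_pos h, one_div_pow]
  refine div_le_div_of_nonneg_right (abs_le.2 ⟨?_, ?_⟩) h.le
  · linarith [Int.lt_floor_add_one (t * 2 ^ n)]
  · linarith [Int.floor_le (t * 2 ^ n)]

lemma tendsto_dyadicFloor (t : ℝ) : Tendsto (fun n => dyadicFloor n t) atTop (𝓝 t) := by
  rw [tendsto_iff_dist_tendsto_zero]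
  exact squeeze_zero (fun _ => dist_nonneg) (fun n => abs_dyadicFloor_sub_le n t)
    (tendsto_pow_atTop_nhds_zero_of_lt_one (by norm_num) (by norm_num))

/-- All dyadic increments of `f` of level at least `n₀` inside `[-N, N]` are at most `r ^ n`. -/
def DyadicIncrementBound (f : ℝ → ℝ) (N n₀ : ℕ) (r : ℝ) : Prop :=
  ∀ n ≥ n₀, ∀ k ∈ Finset.Ico (-(N * 2 ^ n) : ℤ) (N * 2 ^ n),
    |f ((k + 1 : ℤ) / 2 ^ n) - f (k / 2 ^ n)| ≤ r ^ n

variable {f : ℝ → ℝ} {N n₀ : ℕ} {r : ℝ}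

lemma floor_mul_two_pow_mem (n : ℕ) {t : ℝ} (ht : t ∈ Ico (-N : ℝ) N) :
    ⌊t * 2 ^ n⌋ ∈ Finset.Ico (-(N * 2 ^ n) : ℤ) (N * 2 ^ n) := by
  have h : (0 : ℝ) < 2 ^ n := by positivity
  rw [Finset.mem_Ico, Int.le_floor, Int.floor_lt]
  push_cast
  constructor <;> nlinarith [ht.1, ht.2]

/-- Refining the grid either keeps the dyadic floor or moves it by a single cell of level n + 1. -/
lemma DyadicIncrementBound.abs_sub_succ_le (h : DyadicIncrementBound f N n₀ r) (hr : 0 ≤ r)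
    {n : ℕ} (hn : n₀ ≤ n) {t : ℝ} (ht : t ∈ Ico (-N : ℝ) N) :
    |f (dyadicFloor n t) - f (dyadicFloor (n + 1) t)| ≤ r ^ (n + 1) := by
  have hm := floor_mul_two_pow_mem (n + 1) ht
  have hm' := floor_mul_two_pow_mem n ht
  have e : dyadicFloor n t = ((2 * ⌊t * 2 ^ n⌋ : ℤ) : ℝ) / 2 ^ (n + 1) := by
    rw [dyadicFloor, pow_succ]; push_cast; field_simp
  have h1 : 2 * ⌊t * 2 ^ n⌋ ≤ ⌊t * 2 ^ (n + 1)⌋ := by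
    rw [Int.le_floor]; push_cast; rw [pow_succ]; linarith [Int.floor_le (t * 2 ^ n)]
  have h2 : ⌊t * 2 ^ (n + 1)⌋ < 2 * ⌊t * 2 ^ n⌋ + 2 := by
    rw [Int.floor_lt]; push_cast; rw [pow_succ]; linarith [Int.lt_floor_add_one (t * 2 ^ n)]
  rcases (by omega : ⌊t * 2 ^ (n + 1)⌋ = 2 * ⌊t * 2 ^ n⌋ ∨
    ⌊t * 2 ^ (n + 1)⌋ = 2 * ⌊t * 2 ^ n⌋ + 1) with h3 | h3
  · rw [e, dyadicFloor, h3, sub_self, abs_zero]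
    positivity
  · rw [e, dyadicFloor, h3, abs_sub_comm]
    refine h (n + 1) (by omega) _ ?_
    rw [Finset.mem_Ico] at hm hm' ⊢
    rw [pow_succ] at hm ⊢
    constructor
    · linarith [hm'.1]
    · omega

lemma DyadicIncrementBound.abs_dyadicFloor_sub_le (h : DyadicIncrementBound f N n₀ r) (hr : 0 ≤ r)
    (hr1 : r < 1) (hf : Continuous f) {n : ℕ} (hn : n₀ ≤ n) {t : ℝ} (ht : t ∈ Ico (-N : ℝ) N) :
    |f (dyadicFloor n t) - f t| ≤ r ^ n / (1 - r) := by
  have hlim : Tendsto (fun j => f (dyadicFloor (n + j) t)) atTop (𝓝 (f t)) :=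
    (hf.tendsto t).comp ((tendsto_dyadicFloor t).comp (tendsto_add_atTop_nat n |>.congr
      fun j => add_comm j n))
  refine dist_le_of_le_geometric_of_tendsto₀ r (r ^ n) hr1 (fun j => ?_) hlim
  rw [← pow_add]
  refine (h.abs_sub_succ_le hr (by omega) ht).trans ?_
  -- One factor r is given away here to fit the geometric series.
  exact pow_le_pow_of_le_one hr hr1.le (by omega)

/-- At level n the two floors coincide or are adjacent: one increment, plus a chaining tail at each
end. -/
lemma DyadicIncrementBound.abs_sub_le (h : DyadicIncrementBound f N n₀ r) (hr : 0 ≤ r)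
    (hr1 : r < 1) (hf : Continuous f) {n : ℕ} (hn : n₀ ≤ n) {s t : ℝ} (hs : s ∈ Ico (-N : ℝ) N)
    (ht : t ∈ Ico (-N : ℝ) N) (hst : |s - t| ≤ (1 / 2) ^ n) :
    |f s - f t| ≤ (1 + 2 / (1 - r)) * r ^ n := by
  wlog hle : s ≤ t generalizing s t
  · rw [abs_sub_comm] at hst ⊢
    exact this ht hs hst (by linarith)
  have h1 := h.abs_dyadicFloor_sub_le hr hr1 hf hn hs
  have h2 := h.abs_dyadicFloor_sub_le hr hr1 hf hn ht
  have h3 : |f (dyadicFloor n t) - f (dyadicFloor n s)| ≤ r ^ n := by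
    have hp : (0 : ℝ) < 2 ^ n := by positivity
    have hst' : t * 2 ^ n ≤ s * 2 ^ n + 1 := by
      rw [abs_sub_comm, abs_of_nonneg (by linarith), one_div_pow, le_div_iff₀ hp] at hst
      linarith
    have k1 : ⌊s * 2 ^ n⌋ ≤ ⌊t * 2 ^ n⌋ := Int.floor_le_floor (by gcongr)
    have k2 : ⌊t * 2 ^ n⌋ ≤ ⌊s * 2 ^ n⌋ + 1 := by
      rw [← Int.floor_add_one]; exact Int.floor_le_floor hst'
    rcases (by omega : ⌊t * 2 ^ n⌋ = ⌊s * 2 ^ n⌋ ∨ ⌊t * 2 ^ n⌋ = ⌊s * 2 ^ n⌋ + 1) with h3 | h3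
    · rw [dyadicFloor, dyadicFloor, h3, sub_self, abs_zero]; positivity
    · rw [dyadicFloor, dyadicFloor, h3]
      exact h n hn _ (floor_mul_two_pow_mem n hs)
  have e : (1 + 2 / (1 - r)) * r ^ n = r ^ n / (1 - r) + r ^ n + r ^ n / (1 - r) := by ring
  rw [e]
  calc |f s - f t| = |-(f (dyadicFloor n s) - f s) - (f (dyadicFloor n t) - f (dyadicFloor n s)) +
        (f (dyadicFloor n t) - f t)| := by ring_nf
    _ ≤ _ := (abs_add_le _ _).trans (add_le_add ((abs_sub _ _).trans
        (add_le_add (by rwa [abs_neg]) h3)) h2)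

/-- Dyadic increment bounds with ratio `2 ^ (-α)` give a local Hölder modulus of exponent `α`. -/
lemma DyadicIncrementBound.abs_sub_le_rpow {α : ℝ} (hα : 0 < α)
    (h : DyadicIncrementBound f N n₀ ((1 / 2) ^ α)) (hf : Continuous f) :
    ∃ K : ℝ, ∀ δ : ℝ, 0 < δ → δ ≤ (1 / 2) ^ n₀ → ∀ s ∈ Ico (-N : ℝ) N, ∀ t ∈ Ico (-N : ℝ) N,
      |s - t| ≤ δ → |f s - f t| ≤ K * δ ^ α := by
  set r : ℝ := (1 / 2) ^ α with hr_def
  have hr : 0 < r := by positivity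
  have hr1 : r < 1 := Real.rpow_lt_one (by norm_num) (by norm_num) hα
  -- The factor r⁻¹ pays for rounding δ up to a power of 1/2: r^n = r⁻¹ r^(n+1), and r^(n+1) ≤ δ^α.
  refine ⟨(1 + 2 / (1 - r)) * r⁻¹, fun δ hδ hδn s hs t ht hst => ?_⟩
  have hC : 0 ≤ 1 + 2 / (1 - r) := by
    have : 0 < 1 - r := by linarith
    positivity
  obtain ⟨n, hn1, hn2⟩ := exists_nat_pow_near_of_lt_one hδ
    (hδn.trans (pow_le_one₀ (by norm_num) (by norm_num))) (y := (1 / 2 : ℝ)) (by norm_num)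
    (by norm_num)
  have hn : n₀ ≤ n := by
    have : (1 / 2 : ℝ) ^ (n + 1) < (1 / 2) ^ n₀ := hn1.trans_le hδn
    have := (pow_lt_pow_iff_right_of_lt_one₀ (by norm_num : (0 : ℝ) < 1 / 2) (by norm_num)).1 this
    omega
  refine (h.abs_sub_le hr.le hr1 hf hn hs ht (hst.trans hn2)).trans ?_
  rw [mul_assoc]
  refine mul_le_mul_of_nonneg_left ?_ hC
  rw [← div_eq_inv_mul, le_div_iff₀ hr, ← pow_succ, hr_def, ← Real.rpow_natCast,
    ← Real.rpow_mul (by norm_num), mul_comm, Real.rpow_mul (by norm_num), Real.rpow_natCast]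
  exact Real.rpow_le_rpow (by positivity) hn1.le hα.le

end Chaining

variable {Ω : Type*} [MeasurableSpace Ω] {P : Measure Ω}

/-- A polynomial tail bound of arbitrary order for centered Gaussian variables. -/
theorem exists_gaussian_tail_bound (q : ℕ) : ∃ M : ℝ≥0∞, M ≠ ∞ ∧
    ∀ (X : Ω → ℝ) (v : ℝ≥0), HasLaw X (gaussianReal 0 v) P → ∀ y : ℝ, 0 < y →
      P {ω | y ≤ |X ω|} ≤ ENNReal.ofReal ((√v / y) ^ q) * M := by
  -- The constant is the q-th absolute moment of the standard Gaussian; scaling and Markov's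
  -- inequality do the rest.
  refine ⟨∫⁻ z, ENNReal.ofReal (|z| ^ q) ∂gaussianReal 0 1, ?_, fun X v hX y hy => ?_⟩
  · have h : Integrable (fun z : ℝ => ‖z‖ ^ q) (gaussianReal 0 1) :=
      (memLp_id_gaussianReal (μ := 0) (v := 1) q).integrable_norm_pow'
    exact h.lintegral_lt_top.ne
  · have hm := hX.aemeasurable
    have hscale : (gaussianReal 0 1).map (√v * ·) = gaussianReal 0 v := by
      rw [gaussianReal_map_const_mul]
      congr 1
      · simp
      · ext; simp
    have h1 : ∫⁻ ω, ENNReal.ofReal (|X ω| ^ q) ∂P =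
        ENNReal.ofReal (√v ^ q) * ∫⁻ z, ENNReal.ofReal (|z| ^ q) ∂gaussianReal 0 1 := by
      rw [← lintegral_map' (f := fun x => ENNReal.ofReal (|x| ^ q)) (by fun_prop) hm, hX.map_eq,
        ← hscale, lintegral_map (by fun_prop) (by fun_prop), ← lintegral_const_mul _ (by fun_prop)]
      refine lintegral_congr fun z => ?_
      rw [← ENNReal.ofReal_mul (by positivity), abs_mul, mul_pow, abs_of_nonneg (Real.sqrt_nonneg _)]
    have h2 : P {ω | y ≤ |X ω|} ≤
        P {ω | ENNReal.ofReal (y ^ q) ≤ ENNReal.ofReal (|X ω| ^ q)} :=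
      measure_mono fun ω hω => ENNReal.ofReal_le_ofReal (pow_le_pow_left₀ hy.le hω q)
    have hyq : 0 < y ^ q := by positivity
    refine h2.trans ((meas_ge_le_lintegral_div (by fun_prop) (by simpa using hyq)
      ENNReal.ofReal_ne_top).trans_eq ?_)
    rw [h1, div_pow, ENNReal.ofReal_div_of_pos hyq, ENNReal.mul_div_right_comm]

theorem IsTwoSidedBrownian.ae_dyadicIncrementBound {W : ℝ → Ω → ℝ} (hW : IsTwoSidedBrownian W P)
    {r : ℝ} (hr : √(1 / 2) < r) (N : ℕ) :
    ∀ᵐ ω ∂P, ∃ n₀, DyadicIncrementBound (W · ω) N n₀ r := by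
  have hb : 0 < √(1 / 2 : ℝ) := by positivity
  have hr0 : 0 < r := hb.trans hr
  -- Level n has 2N·2^n increments. With this q each is large with probability at most M·4^(-n), so
  -- the union bound is summable and Borel–Cantelli applies.
  obtain ⟨q, hq⟩ := exists_pow_lt_of_lt_one (by norm_num : (0 : ℝ) < 1 / 4)
    ((div_lt_one hr0).2 hr)
  obtain ⟨M, hM, hMt⟩ := exists_gaussian_tail_bound (P := P) q
  let A : ℕ → Set Ω := fun n => ⋃ k ∈ Finset.Ico (-(N * 2 ^ n) : ℤ) (N * 2 ^ n),
    {ω | r ^ n ≤ |W ((k + 1 : ℤ) / 2 ^ n) ω - W (k / 2 ^ n) ω|}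
  have hA : ∀ n, P (A n) ≤ 2 * N * M * (2⁻¹ : ℝ≥0∞) ^ n := fun n => by
    have hterm : ∀ k : ℤ, P {ω | r ^ n ≤ |W ((k + 1 : ℤ) / 2 ^ n) ω - W (k / 2 ^ n) ω|} ≤
        ENNReal.ofReal ((1 / 4) ^ n) * M := fun k => by
      refine (hMt _ _ (hW.hasLaw_sub _ _) (r ^ n) (by positivity)).trans ?_
      gcongr
      have e : (((k + 1 : ℤ) : ℝ) / 2 ^ n - k / 2 ^ n) = (1 / 2) ^ n := by
        push_cast; rw [one_div_pow]; ring
      have e2 : √((1 / 2 : ℝ) ^ n) = √(1 / 2) ^ n := by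
        rw [Real.sqrt_eq_iff_mul_self_eq (by positivity) (by positivity), ← mul_pow,
          Real.mul_self_sqrt (by norm_num)]
      rw [e, abs_of_pos (by positivity), Real.coe_toNNReal _ (by positivity), e2, ← div_pow,
        ← pow_mul, mul_comm, pow_mul]
      exact pow_le_pow_left₀ (by positivity) hq.le n
    refine (measure_biUnion_finset_le _ _).trans ((Finset.sum_le_sum fun k _ => hterm k).trans ?_)
    rw [Finset.sum_const, Int.card_Ico, nsmul_eq_mul]
    have hcard : ((N * 2 ^ n : ℤ) - -(N * 2 ^ n)).toNat = 2 * N * 2 ^ n := by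
      have : ((N * 2 ^ n : ℤ) - -(N * 2 ^ n)) = ((2 * N * 2 ^ n : ℕ) : ℤ) := by push_cast; ring
      rw [this, Int.toNat_natCast]
    rw [hcard]
    have e4 : ENNReal.ofReal ((1 / 4) ^ n) = (2⁻¹ : ℝ≥0∞) ^ n * 2⁻¹ ^ n := by
      rw [← mul_pow, ENNReal.ofReal_pow (by norm_num)]
      congr 1
      rw [← ENNReal.mul_inv (by simp) (by simp), one_div, ENNReal.ofReal_inv_of_pos (by norm_num)]
      norm_num
    have e5 : (2 : ℝ≥0∞) ^ n * 2⁻¹ ^ n = 1 := by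
      rw [← mul_pow, ENNReal.mul_inv_cancel (by simp) (by simp), one_pow]
    rw [e4]
    push_cast
    calc 2 * (N : ℝ≥0∞) * 2 ^ n * (2⁻¹ ^ n * 2⁻¹ ^ n * M)
        = 2 * N * M * 2⁻¹ ^ n * (2 ^ n * 2⁻¹ ^ n) := by ring
      _ ≤ _ := by rw [e5, mul_one]
  have hsum : ∑' n, P (A n) ≠ ∞ := by
    refine ne_top_of_le_ne_top ?_ (ENNReal.tsum_le_tsum hA)
    rw [ENNReal.tsum_mul_left, ENNReal.tsum_geometric]
    refine ENNReal.mul_ne_top (ENNReal.mul_ne_top (ENNReal.mul_ne_top (by simp) (by simp)) hM) ?_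
    rw [ENNReal.one_sub_inv_two, inv_inv]
    simp
  filter_upwards [ae_eventually_notMem hsum] with ω hω
  obtain ⟨n₀, hn₀⟩ := eventually_atTop.1 hω
  refine ⟨n₀, fun n hn k hk => ?_⟩
  have := hn₀ n hn
  simp only [A, mem_iUnion, not_exists, mem_ofPred_eq, not_le] at this
  exact (this k hk).le

/-- Two-sided Brownian motion is almost surely locally Hölder of every exponent below `1 / 2`. -/
theorem IsTwoSidedBrownian.ae_holder {W : ℝ → Ω → ℝ} (hW : IsTwoSidedBrownian W P)
    {α : ℝ} (hα : 0 < α) (hα2 : α < 1 / 2) (N : ℕ) :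
    ∀ᵐ ω ∂P, ∃ K δ₀ : ℝ, 0 < δ₀ ∧ ∀ δ : ℝ, 0 < δ → δ ≤ δ₀ → ∀ s ∈ Ico (-N : ℝ) N,
      ∀ t ∈ Ico (-N : ℝ) N, |s - t| ≤ δ → |W s ω - W t ω| ≤ K * δ ^ α := by
  have hr : √(1 / 2 : ℝ) < (1 / 2) ^ α := by
    rw [Real.sqrt_eq_rpow]
    exact Real.rpow_lt_rpow_of_exponent_gt (by norm_num) (by norm_num) hα2
  filter_upwards [hW.cont, hW.ae_dyadicIncrementBound hr N] with ω hω ⟨n₀, hn₀⟩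
  obtain ⟨K, hK⟩ := hn₀.abs_sub_le_rpow hα hω
  exact ⟨K, (1 / 2) ^ n₀, by positivity, hK⟩

end

/-! ### Pathwise growth of the noise -/

section

variable {Ω : Type*} {ρ : ℝ → ℝ} {γ ε : ℝ}

lemma IsMollifyingKernel.deriv_scaledKernel (hρ : IsMollifyingKernel ρ) (x : ℝ) :
    deriv (scaledKernel ρ γ ε) x = ε ^ (-γ) * (deriv ρ (x / ε ^ γ) / ε ^ γ) := by
  have h1 : HasDerivAt ρ (deriv ρ (x / ε ^ γ)) (x / ε ^ γ) :=
    (hρ.smooth.differentiable (by simp) _).hasDerivAt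
  have h2 := (h1.comp x ((hasDerivAt_id x).div_const (ε ^ γ))).const_mul (ε ^ (-γ))
  rw [← mul_one_div (deriv ρ _)]
  exact h2.deriv

lemma IsMollifyingKernel.integral_abs_deriv_scaledKernel (hρ : IsMollifyingKernel ρ)
    (hε : 0 < ε) (t : ℝ) :
    ∫ s, |deriv (scaledKernel ρ γ ε) (t - s)| = ε ^ (-γ) * ∫ x, |deriv ρ x| := by
  have hδ : 0 < ε ^ γ := Real.rpow_pos_of_pos hε γ
  rw [integral_sub_left_eq_self (fun r => |deriv (scaledKernel ρ γ ε) r|) volume t]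
  simp only [hρ.deriv_scaledKernel, abs_mul, abs_div, abs_of_pos hδ,
    abs_of_pos (Real.rpow_pos_of_pos hε (-γ))]
  rw [integral_const_mul, integral_div, Measure.integral_comp_div (fun x => |deriv ρ x|),
    abs_of_pos hδ, smul_eq_mul, mul_div_cancel_left₀ _ hδ.ne']

lemma IsMollifyingKernel.deriv_scaledKernel_eq_zero (hρ : IsMollifyingKernel ρ) (hε : 0 < ε)
    {x : ℝ} (hx : ε ^ γ < |x|) : deriv (scaledKernel ρ γ ε) x = 0 := by
  refine image_eq_zero_of_notMem_tsupport fun h => ?_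
  have hsub : tsupport (scaledKernel ρ γ ε) ⊆ Icc (-ε ^ γ) (ε ^ γ) := by
    refine closure_minimal (fun y hy => ?_) isClosed_Icc
    by_contra hy'
    rw [mem_Icc, ← abs_le, not_le] at hy'
    exact hy (hρ.scaledKernel_eq_zero hε hy')
  have := hsub (tsupport_deriv_subset h)
  rw [mem_Icc, ← abs_le] at this
  linarith

lemma IsMollifyingKernel.integral_deriv_scaledKernel (hρ : IsMollifyingKernel ρ) (hε : 0 < ε)
    (t : ℝ) : ∫ s, deriv (scaledKernel ρ γ ε) (t - s) = 0 := by
  have hk := hρ.contDiff_scaledKernel γ ε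
  have hs := hρ.hasCompactSupport_scaledKernel (γ := γ) hε
  rw [integral_sub_left_eq_self (fun r => deriv (scaledKernel ρ γ ε) r) volume t]
  exact integral_eq_zero_of_hasDerivAt_of_integrable
    (fun x => (hk.differentiable one_ne_zero x).hasDerivAt)
    ((hk.continuous_deriv le_rfl).integrable_of_hasCompactSupport hs.deriv)
    (hk.continuous.integrable_of_hasCompactSupport hs)

/-- The noise is controlled by the oscillation of the path at scale `ε ^ γ`. -/
lemma IsMollifyingKernel.abs_noise_le (hρ : IsMollifyingKernel ρ) (hε : 0 < ε) {W : ℝ → Ω → ℝ}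
    {ω : Ω} (hw : Continuous (W · ω)) {t D : ℝ}
    (hD : ∀ s, |t - s| ≤ ε ^ γ → |W s ω - W t ω| ≤ D) :
    |noise ρ γ ε W t ω| ≤ ε ^ (-γ) * (∫ x, |deriv ρ x|) * D := by
  have hk := (hρ.contDiff_scaledKernel γ ε).continuous_deriv le_rfl
  have hi : Integrable fun s => deriv (scaledKernel ρ γ ε) (t - s) := by
    simpa using hρ.integrable_deriv_scaledKernel_mul (γ := γ) hε (w := fun _ => 1)
      continuous_const t
  have e : noise ρ γ ε W t ω = ∫ s, deriv (scaledKernel ρ γ ε) (t - s) * (W s ω - W t ω) := by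
    simp only [mul_sub]
    rw [hρ.noise_eq hε hw, integral_sub (hρ.integrable_deriv_scaledKernel_mul hε hw t)
      (hi.mul_const _), integral_mul_const, hρ.integral_deriv_scaledKernel hε, zero_mul, sub_zero]
  rw [e, ← hρ.integral_abs_deriv_scaledKernel (γ := γ) hε t, ← integral_mul_const,
    ← Real.norm_eq_abs]
  refine norm_integral_le_of_norm_le (hi.abs.mul_const D) (ae_of_all _ fun s => ?_)
  rw [norm_mul, Real.norm_eq_abs, Real.norm_eq_abs]
  by_cases h : |t - s| ≤ ε ^ γ
  · exact mul_le_mul_of_nonneg_left (hD s h) (abs_nonneg _)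
  · rw [hρ.deriv_scaledKernel_eq_zero hε (not_le.1 h)]
    simp

variable [MeasurableSpace Ω] {P : Measure Ω} {W : ℝ → Ω → ℝ}

theorem IsTwoSidedBrownian.ae_abs_noise_le (hW : IsTwoSidedBrownian W P)
    (hρ : IsMollifyingKernel ρ) (hγ : 0 < γ) {γ' : ℝ} (hγ' : γ < γ') (T : ℝ) :
    ∀ᵐ ω ∂P, ∃ ε₀ : ℝ, 0 < ε₀ ∧ ∀ ε : ℝ, 0 < ε → ε ≤ ε₀ → ∀ t ∈ Icc (0 : ℝ) T,
      |noise ρ γ ε W t ω| ≤ ε ^ (-(γ' / 2)) := by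
  -- The condition α > 1 - γ'/(2γ) says γ(1 - α) < γ'/2; it is compatible with α < 1/2 exactly
  -- because γ' > γ.
  have hlt : max 0 (1 - γ' / (2 * γ)) < 1 / 2 := by
    refine max_lt (by norm_num) ?_
    have : 1 / 2 < γ' / (2 * γ) := by
      rw [div_lt_div_iff₀ (by norm_num) (by positivity)]; linarith
    linarith
  obtain ⟨α, hα1, hα2⟩ := exists_between hlt
  have hα : 0 < α := (le_max_left _ _).trans_lt hα1
  have hκ : 0 < γ' / 2 - γ * (1 - α) := by
    have h1 : 1 - α < γ' / (2 * γ) := by linarith [(le_max_right _ _).trans_lt hα1]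
    rw [lt_div_iff₀ (by positivity)] at h1
    linarith
  -- Once ε^γ < 1, the window of radius ε^γ around any t in [0, T] stays inside [-N, N).
  obtain ⟨N, hN⟩ := exists_nat_gt (max 1 (T + 1))
  have hN1 : (1 : ℝ) < N := (le_max_left _ _).trans_lt hN
  have hN2 : T + 1 < N := (le_max_right _ _).trans_lt hN
  filter_upwards [hW.cont, hW.ae_holder hα hα2 N] with ω hω ⟨K, δ₀, hδ₀, hK⟩
  have hlim : ∀ κ : ℝ, 0 < κ → Tendsto (fun ε : ℝ => ε ^ κ) (𝓝[>] 0) (𝓝 0) := fun κ hκ => by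
    have := (Real.continuousAt_rpow_const 0 κ (Or.inr hκ.le)).tendsto
    rw [Real.zero_rpow hκ.ne'] at this
    exact this.mono_left nhdsWithin_le_nhds
  -- The spare positive power of ε absorbs the random Hölder constant K, so the final constant is 1
  -- and only ε₀ is random.
  have hev : ∀ᶠ ε in 𝓝[>] (0 : ℝ), ε ^ γ < min δ₀ 1 ∧
      (∫ x, |deriv ρ x|) * K * ε ^ (γ' / 2 - γ * (1 - α)) < 1 := by
    refine ((hlim γ hγ).eventually (gt_mem_nhds (lt_min hδ₀ one_pos))).and ?_
    have := (hlim _ hκ).const_mul ((∫ x, |deriv ρ x|) * K)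
    rw [mul_zero] at this
    exact this.eventually (gt_mem_nhds one_pos)
  obtain ⟨ε₀, hε₀, hsub⟩ := mem_nhdsGT_iff_exists_Ioc_subset.1 hev
  refine ⟨ε₀, hε₀, fun ε hε hεε₀ t ht => ?_⟩
  obtain ⟨h1, h2⟩ := hsub ⟨hε, hεε₀⟩
  have hδ : 0 < ε ^ γ := Real.rpow_pos_of_pos hε γ
  have hb := hρ.abs_noise_le hε hω (t := t) (D := K * (ε ^ γ) ^ α) fun s hs => by
    have hs1 := abs_le.1 (hs.trans (h1.le.trans (min_le_right _ _)))
    refine hK (ε ^ γ) hδ (h1.le.trans (min_le_left _ _)) s ⟨?_, ?_⟩ t ⟨?_, ?_⟩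
      (by rwa [abs_sub_comm]) <;> linarith [ht.1, ht.2, hs1.1, hs1.2]
  refine hb.trans ?_
  have e : ε ^ (-γ) * (∫ x, |deriv ρ x|) * (K * (ε ^ γ) ^ α) =
      ((∫ x, |deriv ρ x|) * K * ε ^ (γ' / 2 - γ * (1 - α))) * ε ^ (-(γ' / 2)) := by
    have : ε ^ (γ' / 2 - γ * (1 - α)) * ε ^ (-(γ' / 2)) = ε ^ (-γ) * (ε ^ γ) ^ α := by
      rw [← Real.rpow_mul hε.le, ← Real.rpow_add hε, ← Real.rpow_add hε]
      congr 1
      ring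
    linear_combination -((∫ x, |deriv ρ x|) * K) * this
  rw [e]
  exact mul_le_of_le_one_left (Real.rpow_nonneg hε.le _) h2.le

end

end MollifiedNoise

end

theorem mainTheorem4 {Ω : Type*} [MeasurableSpace Ω] (P : Measure Ω) [IsProbabilityMeasure P]
    (B B' : ℝ≥0 → Ω → ℝ) (hB : IsBrownianReal B P) (hB' : IsBrownianReal B' P)
    (hindep : IndepFun (fun ω t => B t ω) (fun ω t => B' t ω) P)
    (W : ℝ → Ω → ℝ) (hW : W = MollifiedNoise.twoSided B B')
    (ρ : ℝ → ℝ) (hρ : MollifiedNoise.IsMollifyingKernel ρ) (γ : ℝ) (hγ : 0 < γ) :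
    -- almost surely the mollified process is well defined and differentiable in time
    (∀ᵐ ω ∂P, ∀ ε : ℝ, 0 < ε →
      (∀ t : ℝ, Integrable (fun s => MollifiedNoise.scaledKernel ρ γ ε (t - s) * W s ω)) ∧
      Differentiable ℝ (fun t => MollifiedNoise.mollified ρ γ ε W t ω)) ∧
    -- stationary centered Gaussian process with the given variance
    (∀ ε : ℝ, 0 < ε →
      MollifiedNoise.IsStationary (MollifiedNoise.noise ρ γ ε W) P ∧
      IsGaussianProcess (MollifiedNoise.noise ρ γ ε W) P ∧
      (∀ t : ℝ, ∫ ω, MollifiedNoise.noise ρ γ ε W t ω ∂P = 0) ∧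
      (∀ t : ℝ, ∫ ω, MollifiedNoise.noise ρ γ ε W t ω ^ 2 ∂P = ε ^ (-γ) * ∫ x, ρ x ^ 2)) ∧
    -- correlation length
    (∀ ε : ℝ, 0 < ε → ∀ s t : ℝ, 2 * ε ^ γ ≤ |s - t| →
      IndepFun (MollifiedNoise.noise ρ γ ε W s) (MollifiedNoise.noise ρ γ ε W t) P) ∧
    -- pathwise growth bound
    (∀ γ' : ℝ, γ < γ' → ∀ T : ℝ, 0 < T → ∃ C : ℝ, ∀ᵐ ω ∂P, ∃ ε₀ : ℝ, 0 < ε₀ ∧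
      ∀ ε : ℝ, 0 < ε → ε ≤ ε₀ → ∀ t ∈ Icc (0 : ℝ) T,
        |MollifiedNoise.noise ρ γ ε W t ω| ≤ C * ε ^ (-(γ' / 2))) ∧
    -- the special case of the exponent one third
    (γ < 2 / 3 → ∀ T : ℝ, 0 < T → ∃ C : ℝ, ∀ᵐ ω ∂P, ∃ ε₀ : ℝ, 0 < ε₀ ∧
      ∀ ε : ℝ, 0 < ε → ε ≤ ε₀ → ∀ t ∈ Icc (0 : ℝ) T,
        |MollifiedNoise.noise ρ γ ε W t ω| ≤ C * ε ^ (-(1 / 3 : ℝ))) := by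
  subst hW
  have hW := MollifiedNoise.isTwoSidedBrownian_twoSided hB hB' hindep
  refine ⟨?_, fun ε hε => ⟨hW.isStationary_noise hρ hε, hW.isGaussianProcess_noise hρ hε,
    hW.integral_noise hρ hε, hW.integral_noise_sq hρ hε⟩,
    fun ε hε s t hst => hW.indepFun_noise hρ hε hst, fun γ' hγ' T _ => ⟨1, ?_⟩,
    fun hγ3 T _ => ⟨1, ?_⟩⟩
  · filter_upwards [hW.cont] with ω hω ε hε
    exact ⟨hρ.integrable_scaledKernel_mul hε hω,
      fun t => (hρ.hasDerivAt_mollified hε hω t).differentiableAt⟩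
  · simpa only [one_mul] using hW.ae_abs_noise_le hρ hγ hγ' T
  -- The choice γ' = 2/3 yields the exponent 1/3.
  · have h := hW.ae_abs_noise_le hρ hγ hγ3 T
    norm_num at h ⊢
    exact h
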